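/- Let $X$ be a complete CAT(0) space, let $\partial X$ be its visual boundary (the set of asymptote classes of geodesic rays in $X$), and let $\overline X = X\cup\partial X$ be its visual bordification, with the cone topology (generated by the open subsets of $X$ and the sets $U(c,r,\varepsilon)=\{x\in\overline X : d(x,c(0))>r,\ d(p_r(x),c(r))<\varepsilon\}$, where $c$ is a geodesic ray, $r,\varepsilon>0$, and $p_r(x)$ is the point at distance $r$ from $c(0)$ on the geodesic segment or ray from $c(0)$ to $x$; here $d(\xi,c(0))=\infty$ for $\xi\in\partial X$). Fix a base point $x_0\in X$. For $W\subset\overline X$ and $C\ge 0$ let $$H(W,C)=\{z\in X : d(z,W)\le d(z,x_0)+C\},\qquad d(z,W)=\inf_{w\in W}d(z,w),$$ where $d(z,w)=\infty$ for $w\in\partial X$. For $\xi\in\partial X$ let $\mathcal V_\xi$ be the collection of open neighborhoods of $\xi$ in $\overline X$, and define the star based at $x_0$ and the star of $\xi$ by $$S^{x_0}(\xi)=\bigcap_{V\in\mathcal V_\xi}\overline{H(V,0)},\qquad S(\xi)=\overline{\bigcup_{C\ge 0}\ \bigcap_{V\in\mathcal V_\xi}\overline{H(V,C)}},$$ with closures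 taken in $\overline X$. For $\xi,\eta\in\partial X$ let $\angle(\eta,\xi)=\sup_{p\in X}\angle_p(\eta,\xi)$, where $\angle_p(\eta,\xi)$ is the Alexandrov angle at $p$ between the geodesic rays from $p$ to $\eta$ and to $\xi$. Then for every $x_0\in X$ and every $\xi\in\partial X$ $$S(\xi)=S^{x_0}(\xi)=\{\eta\in\partial X : \angle(\eta,\xi)\le \pi/2\}.$$ -/

import Mathlib

open Set Filter Topology
open scoped NNReal ENNReal

noncomputable section

/-! ### CAT(0) spaces -/

/-- `γ`, restricted to `[0, dist x y]`, is a geodesic segment from `x` to `y`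
parametrized by arc length. -/
structure IsGeodesicSegment {X : Type*} [MetricSpace X] (γ : ℝ → X) (x y : X) : Prop where
  source : γ 0 = x
  target : γ (dist x y) = y
  dist_eq : ∀ s ∈ Icc (0 : ℝ) (dist x y), ∀ t ∈ Icc (0 : ℝ) (dist x y),
    dist (γ s) (γ t) = |s - t|

/-- A CAT(0) space: a geodesic metric space all of whose geodesic triangles are at least as thin
as their comparison triangles in the Euclidean plane. Two different sides of a triangle always
share a vertex, here called `x`; `x'`, `y'`, `z'` are the vertices of a comparison triangle and
`p'`, `q'` are the comparison points of `γ₁ s ∈ [x, y]` and `γ₂ t ∈ [x, z]`. -/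
structure IsCAT0 (X : Type*) [MetricSpace X] : Prop where
  exists_segment : ∀ x y : X, ∃ γ : ℝ → X, IsGeodesicSegment γ x y
  comparison : ∀ (x y z : X) (γ₁ γ₂ : ℝ → X),
    IsGeodesicSegment γ₁ x y → IsGeodesicSegment γ₂ x z →
    ∀ x' y' z' : EuclideanSpace ℝ (Fin 2),
      dist x' y' = dist x y → dist x' z' = dist x z → dist y' z' = dist y z →
    ∀ s ∈ Icc (0 : ℝ) (dist x y), ∀ t ∈ Icc (0 : ℝ) (dist x z),
    ∀ p' q' : EuclideanSpace ℝ (Fin 2),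
      dist x' p' = s → dist p' y' = dist x y - s →
      dist x' q' = t → dist q' z' = dist x z - t →
      dist (γ₁ s) (γ₂ t) ≤ dist p' q'

/-! ### The visual boundary -/

/-- A geodesic ray: an isometric map `[0, ∞) → X`. -/
structure GeodesicRay (X : Type*) [MetricSpace X] where
  toFun : ℝ≥0 → X
  isometry : Isometry toFun

instance GeodesicRay.instCoeFun {X : Type*} [MetricSpace X] :
    CoeFun (GeodesicRay X) (fun _ => ℝ≥0 → X) := ⟨GeodesicRay.toFun⟩

/-- Two rays are asymptotic if they stay at bounded distance from each other. -/
def GeodesicRay.Asymptotic {X : Type*} [MetricSpace X] (c c' : GeodesicRay X) : Prop :=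
  ∃ K : ℝ, ∀ t : ℝ≥0, dist (c t) (c' t) ≤ K

theorem GeodesicRay.asymptotic_equivalence (X : Type*) [MetricSpace X] :
    Equivalence (GeodesicRay.Asymptotic (X := X)) where
  refl c := ⟨0, fun t => by simp⟩
  symm := fun ⟨K, h⟩ => ⟨K, fun t => by rw [dist_comm]; exact h t⟩
  trans := fun ⟨K, h⟩ ⟨L, h'⟩ =>
    ⟨K + L, fun t => (dist_triangle _ _ _).trans (add_le_add (h t) (h' t))⟩

def GeodesicRay.setoid (X : Type*) [MetricSpace X] : Setoid (GeodesicRay X) :=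
  ⟨GeodesicRay.Asymptotic, GeodesicRay.asymptotic_equivalence X⟩

/-- The visual boundary: asymptote classes of geodesic rays. -/
def VisualBoundary (X : Type*) [MetricSpace X] : Type _ := Quotient (GeodesicRay.setoid X)

/-- The class `c(∞)` of a ray `c` in the visual boundary. -/
def GeodesicRay.endpoint {X : Type*} [MetricSpace X] (c : GeodesicRay X) : VisualBoundary X :=
  Quotient.mk (GeodesicRay.setoid X) c

/-! ### The visual bordification -/

/-- The disjoint union of `X` and its visual boundary. -/
inductive VisualBordification (X : Type*) [MetricSpace X] where
  | point (x : X) : VisualBordification X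
  | ideal (ξ : VisualBoundary X) : VisualBordification X

/-- The set `U(c, r, ε)` of all `x` in the bordification such that `d(x, c(0)) > r` and
`d(p_r(x), c(r)) < ε`, where `p_r(x)` is the point at distance `r` from `c(0)` on the geodesic
segment or ray that joins `c(0)` to `x` (which is unique in a complete CAT(0) space);
`d(ξ, c(0)) = ∞` for boundary points `ξ`. -/
def coneNeighborhood {X : Type*} [MetricSpace X] (c : GeodesicRay X) (r : ℝ≥0) (ε : ℝ) :
    Set (VisualBordification X) :=
  {p | match p with
    | .point x => (r : ℝ) < dist (c 0) x ∧
        ∃ γ : ℝ → X, IsGeodesicSegment γ (c 0) x ∧ dist (γ r) (c r) < ε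
    | .ideal ξ => ∃ c' : GeodesicRay X, c' 0 = c 0 ∧ c'.endpoint = ξ ∧ dist (c' r) (c r) < ε}

/-- The cone topology, generated by the open subsets of `X` and the sets `U(c, r, ε)` for all
geodesic rays `c` and all `r, ε > 0`. -/
instance VisualBordification.instTopologicalSpace {X : Type*} [MetricSpace X] :
    TopologicalSpace (VisualBordification X) :=
  TopologicalSpace.generateFrom
    ({W | ∃ U : Set X, IsOpen U ∧ W = VisualBordification.point '' U} ∪
      {W | ∃ (c : GeodesicRay X) (r : ℝ≥0) (ε : ℝ), 0 < r ∧ 0 < ε ∧ W = coneNeighborhood c r ε})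

/-! ### Angles -/

/-- The angle at the vertex corresponding to `p` in a Euclidean comparison triangle for
`p, x, y`, by the law of cosines (used for `x ≠ p ≠ y`). -/
def comparisonAngle {X : Type*} [MetricSpace X] (p x y : X) : ℝ :=
  Real.arccos ((dist p x ^ 2 + dist p y ^ 2 - dist x y ^ 2) / (2 * dist p x * dist p y))

/-- The Alexandrov angle at `c 0` between two rays `c`, `c'` with the same origin: the upper limit
of the comparison angles of `c 0`, `c t`, `c' t'` as `t, t' → 0` through positive values. -/
def alexandrovAngle {X : Type*} [MetricSpace X] (c c' : GeodesicRay X) : ℝ :=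
  limsup (fun q : ℝ≥0 × ℝ≥0 => comparisonAngle (c 0) (c q.1) (c' q.2))
    (𝓝[>] (0 : ℝ≥0) ×ˢ 𝓝[>] (0 : ℝ≥0))

/-- The angular metric `∠(ξ, η)`: the supremum over `p : X` of the angle `∠_p(ξ, η)` at `p` between
the rays from `p` to `ξ` and to `η` (which exist and are unique in a complete CAT(0) space). -/
def boundaryAngle {X : Type*} [MetricSpace X] (ξ η : VisualBoundary X) : ℝ :=
  sSup {θ : ℝ | ∃ (p : X) (c c' : GeodesicRay X), c 0 = p ∧ c' 0 = p ∧
    c.endpoint = ξ ∧ c'.endpoint = η ∧ θ = alexandrovAngle c c'}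

/-! ### Halfspaces and stars, for a space `Y` that contains `X` through a map `ι : X → Y` -/

/-- The halfspace `H(W, C) = {z ∈ X | d(z, W) ≤ d(z, x₀) + C}` of a subset `W` of `Y`. Points of `Y`
outside `X` are at distance `∞` from `z`, so that `d(z, W)` is the infimum of `d(z, w)` over the
points `w` of `X` in `W`, and is `∞` if there are none. -/
def halfspace {X Y : Type*} [MetricSpace X] (ι : X → Y) (x₀ : X) (W : Set Y) (C : ℝ≥0) : Set X :=
  {z | Metric.infEDist z (ι ⁻¹' W) ≤ edist z x₀ + (C : ℝ≥0∞)}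

/-- `⋂ closure (H(V, C))` over the open neighborhoods `V` of `ξ` in `Y`. -/
def halfspaceCore {X Y : Type*} [MetricSpace X] [TopologicalSpace Y] (ι : X → Y) (x₀ : X) (C : ℝ≥0)
    (ξ : Y) : Set Y :=
  ⋂ V ∈ {V : Set Y | IsOpen V ∧ ξ ∈ V}, closure (ι '' halfspace ι x₀ V C)

/-- The star of `ξ` based at `x₀`. -/
def basedStar {X Y : Type*} [MetricSpace X] [TopologicalSpace Y] (ι : X → Y) (x₀ : X) (ξ : Y) :
    Set Y :=
  halfspaceCore ι x₀ 0 ξ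

/-- The star of `ξ` (written with an auxiliary base point `x₀`). -/
def starAtInfinity {X Y : Type*} [MetricSpace X] [TopologicalSpace Y] (ι : X → Y) (x₀ : X) (ξ : Y) :
    Set Y :=
  closure (⋃ C : ℝ≥0, halfspaceCore ι x₀ C ξ)

end

/-! The based star lies in the star trivially, so two inclusions remain.

If `∠(η, ξ) > π/2`, some vertex `p` and points `c u`, `c' v` on its rays to `η`, `ξ` have comparison
angle above `π/2`. By CAT(0) comparison the angle persists outwards: for all `z` near `η` and `w`
near `ξ` the comparison angle at `p` has cosine at most `-κ`, so `d(z, w) ≥ d(p, z) + κ d(p, w)`.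
Taking `w` far from `p` beats `d(z, x₀) + C` for any `C`, so `η` is not in the star
(`ideal_notMem_starAtInfinity`).

If `∠(η, ξ) ≤ π/2`, first variation shows that the Busemann function of `η` based at `x₀` stays
nonpositive along the ray from `x₀` to `ξ` (`busemann_apply_nonpos`). Hence far points of the ray to
`η` are, up to an arbitrarily small error, no farther from that ray's points than from `x₀`;
openness of `V` absorbs the error, even for `C = 0` (`ideal_mem_basedStar`). -/

/-! ### Euclidean comparison and the law of cosines -/

theorem exists_comparison_configuration {a b d : ℝ} (ha : 0 < a) (hb : 0 < b)
    (h₁ : d ≤ a + b) (h₂ : |a - b| ≤ d) :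
    ∃ e f : EuclideanSpace ℝ (Fin 2), ‖e‖ = 1 ∧ ‖f‖ = 1 ∧
      inner ℝ e f = (a ^ 2 + b ^ 2 - d ^ 2) / (2 * a * b) := by
  set k := (a ^ 2 + b ^ 2 - d ^ 2) / (2 * a * b) with hk
  have hd : 0 ≤ d := (abs_nonneg _).trans h₂
  have hab : 0 < 2 * a * b := by positivity
  have hk1 : k ≤ 1 := by
    rw [hk, div_le_one hab]
    have := sq_le_sq' (by linarith [abs_nonneg (a - b)]) h₂
    rw [sq_abs] at this
    linarith
  have hk2 : -1 ≤ k := by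
    rw [hk, le_div_iff₀ hab]
    have := pow_le_pow_left₀ hd h₁ 2
    linarith
  have hk3 : 0 ≤ 1 - k ^ 2 := by nlinarith
  refine ⟨!₂[1, 0], !₂[k, √(1 - k ^ 2)], ?_, ?_, ?_⟩
  · simp [EuclideanSpace.norm_eq]
  · simp [EuclideanSpace.norm_eq, Real.sq_sqrt hk3]
  · simp [PiLp.inner_apply]

theorem dist_smul_smul_sq {V : Type*} [NormedAddCommGroup V] [InnerProductSpace ℝ V] {e f : V}
    (he : ‖e‖ = 1) (hf : ‖f‖ = 1) (s t : ℝ) :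
    dist (s • e) (t • f) ^ 2 = s ^ 2 + t ^ 2 - 2 * (s * t) * inner ℝ e f := by
  rw [dist_eq_norm, norm_sub_sq_real, norm_smul, norm_smul, he, hf, inner_smul_left,
    inner_smul_right]
  simp only [Real.norm_eq_abs, mul_one, sq_abs, conj_trivial]
  ring

namespace IsGeodesicSegment

variable {X : Type*} [MetricSpace X] {x y : X} {γ : ℝ → X}

theorem dist_source (h : IsGeodesicSegment γ x y) {s : ℝ} (hs : s ∈ Icc 0 (dist x y)) :
    dist x (γ s) = s := by
  have := h.dist_eq 0 ⟨le_rfl, dist_nonneg⟩ s hs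
  rwa [h.source, zero_sub, abs_neg, abs_of_nonneg hs.1] at this

theorem dist_target (h : IsGeodesicSegment γ x y) {s : ℝ} (hs : s ∈ Icc 0 (dist x y)) :
    dist (γ s) y = dist x y - s := by
  have := h.dist_eq s hs _ ⟨dist_nonneg, le_rfl⟩
  rwa [h.target, abs_sub_comm, abs_of_nonneg (sub_nonneg.2 hs.2)] at this

theorem reverse (h : IsGeodesicSegment γ x y) :
    IsGeodesicSegment (fun s => γ (dist x y - s)) y x := by
  refine ⟨by simp [h.target], by simp [dist_comm y x, h.source], fun s hs t ht => ?_⟩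
  rw [dist_comm y x] at hs ht
  rw [h.dist_eq _ ⟨by linarith [hs.2], by linarith [hs.1]⟩ _
    ⟨by linarith [ht.2], by linarith [ht.1]⟩, abs_sub_comm]
  congr 1
  ring

end IsGeodesicSegment

namespace IsCAT0

variable {X : Type*} [MetricSpace X] {x y z : X} {γ₁ γ₂ : ℝ → X} {s t : ℝ}

/-- The law of cosines form of the CAT(0) inequality for two sides with a common vertex. -/
theorem sq_dist_mul_le (hX : IsCAT0 X) (h₁ : IsGeodesicSegment γ₁ x y)
    (h₂ : IsGeodesicSegment γ₂ x z) (hy : 0 < dist x y) (hz : 0 < dist x z)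
    (hs : s ∈ Icc 0 (dist x y)) (ht : t ∈ Icc 0 (dist x z)) :
    dist (γ₁ s) (γ₂ t) ^ 2 * (dist x y * dist x z) ≤
      (s ^ 2 + t ^ 2) * (dist x y * dist x z) -
        s * t * (dist x y ^ 2 + dist x z ^ 2 - dist y z ^ 2) := by
  obtain ⟨e, f, he, hf, hef⟩ := exists_comparison_configuration (d := dist y z) hy hz
    (by simpa [dist_comm y x] using dist_triangle y x z)
    (by simpa [dist_comm x] using abs_dist_sub_le y z x)
  have key := hX.comparison x y z γ₁ γ₂ h₁ h₂ 0 (dist x y • e) (dist x z • f)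
    (by simp [norm_smul, he]) (by simp [norm_smul, hf])
    (by
      rw [← sq_eq_sq₀ dist_nonneg dist_nonneg, dist_smul_smul_sq he hf, hef]
      field_simp
      ring) s hs t ht (s • e) (t • f)
    (by simp [norm_smul, he, abs_of_nonneg hs.1])
    (by
      rw [dist_comm, dist_eq_norm, ← sub_smul, norm_smul, he, mul_one, Real.norm_eq_abs,
        abs_of_nonneg (sub_nonneg.2 hs.2)])
    (by simp [norm_smul, hf, abs_of_nonneg ht.1])
    (by
      rw [dist_comm, dist_eq_norm, ← sub_smul, norm_smul, hf, mul_one, Real.norm_eq_abs,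
        abs_of_nonneg (sub_nonneg.2 ht.2)])
  have hsq := pow_le_pow_left₀ dist_nonneg key 2
  rw [dist_smul_smul_sq he hf, hef] at hsq
  refine (mul_le_mul_of_nonneg_right hsq (mul_pos hy hz).le).trans_eq ?_
  field_simp

/-- At equal parameters the law of cosines leaves only the excess of `dist y z` over the difference
of the side lengths; this drives the convergence of long segments. -/
theorem sq_dist_mul_le_of_eq (hX : IsCAT0 X) (h₁ : IsGeodesicSegment γ₁ x y)
    (h₂ : IsGeodesicSegment γ₂ x z) (hy : 0 < dist x y) (hz : 0 < dist x z)
    (hs : s ∈ Icc 0 (dist x y)) (hs' : s ∈ Icc 0 (dist x z)) :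
    dist (γ₁ s) (γ₂ s) ^ 2 * (dist x y * dist x z) ≤
      s ^ 2 * (dist y z ^ 2 - (dist x y - dist x z) ^ 2) := by
  linarith [hX.sq_dist_mul_le h₁ h₂ hy hz hs hs']

theorem dist_le_of_eq (hX : IsCAT0 X) (h₁ : IsGeodesicSegment γ₁ x y)
    (h₂ : IsGeodesicSegment γ₂ x z) (hs : s ∈ Icc 0 (dist x y)) (hs' : s ∈ Icc 0 (dist x z)) :
    dist (γ₁ s) (γ₂ s) ≤ dist y z := by
  rcases hs.1.eq_or_lt with rfl | hs0
  · simp [h₁.source, h₂.source]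
  have hy := hs0.trans_le hs.2
  have hz := hs0.trans_le hs'.2
  have h := hX.sq_dist_mul_le_of_eq h₁ h₂ hy hz hs hs'
  have hsm : s ^ 2 ≤ dist x y * dist x z := by
    rw [sq]; exact mul_le_mul hs.2 hs'.2 hs0.le hy.le
  refine (sq_le_sq₀ dist_nonneg dist_nonneg).1 ?_
  have hyz : 0 < dist x y * dist x z := mul_pos hy hz
  refine le_of_mul_le_mul_right ?_ hyz
  nlinarith [sq_nonneg (dist x y - dist x z), sq_nonneg (dist y z), sq_nonneg s,
    mul_nonneg (sq_nonneg s) (sq_nonneg (dist x y - dist x z)),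
    mul_le_mul_of_nonneg_left hsm (sq_nonneg (dist y z))]

end IsCAT0

/-! ### Geodesic rays -/

namespace GeodesicRay

variable {X : Type*} [MetricSpace X]

theorem dist_apply (c : GeodesicRay X) (s t : ℝ≥0) : dist (c s) (c t) = |(s : ℝ) - t| := by
  rw [c.isometry.dist_eq, NNReal.dist_eq]

theorem dist_zero_apply (c : GeodesicRay X) (t : ℝ≥0) : dist (c 0) (c t) = t := by
  simp [dist_apply]

theorem isGeodesicSegment (c : GeodesicRay X) (T : ℝ≥0) :
    IsGeodesicSegment (fun s => c s.toNNReal) (c 0) (c T) := by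
  refine ⟨by simp, by simp [dist_zero_apply], fun s hs t ht => ?_⟩
  rw [dist_apply, Real.coe_toNNReal _ hs.1, Real.coe_toNNReal _ ht.1]

theorem endpoint_eq_iff {c c' : GeodesicRay X} : c.endpoint = c'.endpoint ↔ c.Asymptotic c' :=
  Quotient.eq (r := GeodesicRay.setoid X)

theorem exists_endpoint_eq (ξ : VisualBoundary X) : ∃ c : GeodesicRay X, c.endpoint = ξ :=
  Quotient.exists_rep ξ

theorem tendsto_dist_atTop (c : GeodesicRay X) (p : X) :
    Tendsto (fun T => dist p (c T)) atTop atTop := by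
  refine tendsto_atTop_mono (f := fun T : ℝ≥0 => (T : ℝ) - dist p (c 0)) (fun T => ?_)
    (tendsto_atTop_add_const_right _ _ (NNReal.tendsto_coe_atTop.2 tendsto_id))
  have := dist_triangle_left (c 0) (c T) p
  rw [dist_zero_apply] at this
  linarith

/-- The ray `t ↦ c (s + t)`. -/
def shift (c : GeodesicRay X) (s : ℝ≥0) : GeodesicRay X where
  toFun t := c (s + t)
  isometry := c.isometry.comp (Isometry.of_dist_eq fun a b => by simp [NNReal.dist_eq])

theorem shift_apply (c : GeodesicRay X) (s t : ℝ≥0) : c.shift s t = c (s + t) := rfl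

theorem endpoint_shift (c : GeodesicRay X) (s : ℝ≥0) : (c.shift s).endpoint = c.endpoint :=
  endpoint_eq_iff.2 ⟨s, fun t => by simp [shift_apply, dist_apply]⟩

end GeodesicRay

/-! ### Limits of segments and existence of rays -/

namespace IsCAT0

variable {X : Type*} [MetricSpace X]

/-- Segments from the origin of a ray to the points of an asymptotic ray converge to the ray. -/
theorem tendsto_segment (hX : IsCAT0 X) {c c' : GeodesicRay X} (h : c.Asymptotic c')
    {σ : ℝ≥0 → ℝ → X} (hσ : ∀ T, IsGeodesicSegment (σ T) (c 0) (c' T)) (v : ℝ≥0) :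
    Tendsto (fun T => σ T v) atTop (𝓝 (c v)) := by
  obtain ⟨K, hK⟩ := h
  have hlim : Tendsto (fun T : ℝ≥0 => √((v : ℝ) ^ 2 * K ^ 2 / (dist (c 0) (c' T) * T)))
      atTop (𝓝 0) := by
    rw [← Real.sqrt_zero]
    exact (Real.continuous_sqrt.tendsto 0).comp (tendsto_const_nhds.div_atTop
      ((c'.tendsto_dist_atTop (c 0)).atTop_mul_atTop₀ (NNReal.tendsto_coe_atTop.2 tendsto_id)))
  rw [tendsto_iff_dist_tendsto_zero]
  refine squeeze_zero' (.of_forall fun _ => dist_nonneg) ?_ hlim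
  filter_upwards [(c'.tendsto_dist_atTop (c 0)).eventually_ge_atTop v,
    (c'.tendsto_dist_atTop (c 0)).eventually_gt_atTop 0, eventually_ge_atTop v,
    eventually_gt_atTop 0] with T h₁ h₂ h₃ h₄
  have hT : (0 : ℝ) < T := h₄
  refine Real.le_sqrt_of_sq_le ?_
  rw [le_div_iff₀ (mul_pos h₂ hT)]
  have key := hX.sq_dist_mul_le_of_eq (s := v) (hσ T) (c.isGeodesicSegment T) h₂
    (by rwa [c.dist_zero_apply]) ⟨v.coe_nonneg, h₁⟩ ⟨v.coe_nonneg, by rw [c.dist_zero_apply]; exact h₃⟩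
  rw [c.dist_zero_apply, Real.toNNReal_coe] at key
  refine key.trans (mul_le_mul_of_nonneg_left ?_ (sq_nonneg _))
  have h5 : dist (c' T) (c T) ^ 2 ≤ K ^ 2 :=
    pow_le_pow_left₀ dist_nonneg (by rw [dist_comm]; exact hK T) 2
  linarith [sq_nonneg (dist (c 0) (c' T) - T)]

/-- With `D = dist p (c 0)`, comparison of the segments to `c T` and `c N`, `T ≥ N`, bounds the
squared distance at time `v` by `4 D v² / (N - D)`. -/
theorem cauchySeq_segment (hX : IsCAT0 X) {p : X} {c : GeodesicRay X} {σ : ℝ≥0 → ℝ → X}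
    (hσ : ∀ T, IsGeodesicSegment (σ T) p (c T)) (v : ℝ≥0) :
    CauchySeq fun T => σ T v := by
  set D := dist p (c 0)
  have hD : 0 ≤ D := dist_nonneg
  have hlim : Tendsto (fun T : ℝ≥0 => (v : ℝ) ^ 2 * (4 * D) / (T - D)) atTop (𝓝 0) :=
    tendsto_const_nhds.div_atTop
      (tendsto_atTop_add_const_right _ _ (NNReal.tendsto_coe_atTop.2 tendsto_id))
  rw [Metric.cauchySeq_iff']
  intro ε hε
  have hev : ∀ᶠ T : ℝ≥0 in atTop, D + v < T :=
    (NNReal.tendsto_coe_atTop.2 tendsto_id).eventually_gt_atTop (D + v)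
  obtain ⟨N, hN, hN'⟩ := ((hlim.eventually_lt_const (pow_pos hε 2)).and hev).exists
  refine ⟨N, fun T hT => ?_⟩
  have hT' : (N : ℝ) ≤ T := hT
  have hv := v.coe_nonneg
  have low : ∀ S : ℝ≥0, (S : ℝ) - D ≤ dist p (c S) := fun S => by
    have := dist_triangle_left (c 0) (c S) p
    rw [c.dist_zero_apply] at this
    linarith
  have up : ∀ S : ℝ≥0, dist p (c S) ≤ S + D := fun S => by
    have := dist_triangle p (c 0) (c S)
    rw [c.dist_zero_apply] at this
    linarith
  have hd : dist (c T) (c N) = T - N := by rw [c.dist_apply, abs_of_nonneg (by linarith)]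
  have l₁ := low T
  have l₂ := low N
  have u₁ := up N
  have key := hX.sq_dist_mul_le_of_eq (s := v) (hσ T) (hσ N) (by linarith) (by linarith)
    ⟨v.coe_nonneg, by linarith⟩ ⟨v.coe_nonneg, by linarith⟩
  have hNT := abs_dist_sub_le (c T) (c N) p
  rw [hd, abs_le] at hNT
  rw [hd] at key
  rw [dist_comm (c T) p, dist_comm (c N) p] at hNT
  set a := dist p (c T)
  set b := dist p (c N)
  have hb : 0 < b := by linarith
  have ha : 0 < a := by linarith
  refine lt_of_pow_lt_pow_left₀ 2 hε.le (lt_of_le_of_lt ?_ hN)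
  -- Factor the difference of squares: one factor is at most `2 D`, the other at most `2 (T - N) ≤ 2
  -- a`.
  rw [le_div_iff₀ (by linarith)]
  have e₁ : ((T : ℝ) - N) ^ 2 - (a - b) ^ 2 ≤ 4 * D * a := by
    have : ((T : ℝ) - N) ^ 2 - (a - b) ^ 2 ≤ 2 * D * (2 * (T - N)) := by
      have h1 : (T : ℝ) - N - (a - b) ≤ 2 * D := by linarith
      nlinarith [mul_le_mul h1 (show (T : ℝ) - N + (a - b) ≤ 2 * (T - N) by linarith)
        (by linarith) (by linarith)]
    nlinarith
  have e₂ : dist (σ T v) (σ N v) ^ 2 * b * a ≤ v ^ 2 * (4 * D) * a := by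
    nlinarith [mul_le_mul_of_nonneg_left e₁ (sq_nonneg (v : ℝ))]
  exact (mul_le_mul_of_nonneg_left l₂ (sq_nonneg _)).trans (le_of_mul_le_mul_right e₂ ha)

/-- For `v ≤ dist p (c 0)` go through both origins. Otherwise compare from the common end `c T`,
where the two parametrizations differ by at most `dist p (c 0)`. The bound is uniform in `T`, so the
limit ray is asymptotic to `c`. -/
theorem dist_segment_le (hX : IsCAT0 X) {p : X} {c : GeodesicRay X} {T v : ℝ≥0} {σ : ℝ → X}
    (hσ : IsGeodesicSegment σ p (c T)) (hv : (v : ℝ) ≤ dist p (c T)) (hvT : v ≤ T) :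
    dist (σ v) (c v) ≤ 3 * dist p (c 0) := by
  have hvT' : (v : ℝ) ≤ T := hvT
  have hv0 := v.coe_nonneg
  have hab := abs_dist_sub_le p (c 0) (c T)
  rw [c.dist_zero_apply, abs_le] at hab
  rcases le_total (v : ℝ) (dist p (c 0)) with h | h
  · have h₁ := hσ.dist_source ⟨v.coe_nonneg, hv⟩
    have h₂ := dist_triangle4 (σ v) p (c 0) (c v)
    rw [c.dist_zero_apply, dist_comm _ p] at h₂
    linarith
  · have hr := (c.isGeodesicSegment T).reverse
    have hr' := hσ.reverse
    have h₀ : (0 : ℝ) ≤ T - v := by linarith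
    have key := hX.dist_le_of_eq hr' hr (s := T - v)
      ⟨h₀, by rw [dist_comm]; linarith⟩ ⟨h₀, by rw [dist_comm, c.dist_zero_apply]; linarith⟩
    simp only [c.dist_zero_apply, sub_sub_cancel, Real.toNNReal_coe] at key
    have h₃ := hσ.dist_eq v ⟨v.coe_nonneg, hv⟩ (dist p (c T) - (T - v)) ⟨by linarith, by linarith⟩
    have h₄ : |(v : ℝ) - (dist p (c T) - (T - v))| ≤ dist p (c 0) :=
      abs_le.2 ⟨by linarith, by linarith⟩
    linarith [dist_triangle (σ v) (σ (dist p (c T) - (T - v))) (c v)]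

/-- In a complete CAT(0) space, every point is the origin of a ray in each asymptote class. -/
theorem exists_ray (hX : IsCAT0 X) [CompleteSpace X] (p : X) (ξ : VisualBoundary X) :
    ∃ c : GeodesicRay X, c 0 = p ∧ c.endpoint = ξ := by
  obtain ⟨c, rfl⟩ := GeodesicRay.exists_endpoint_eq ξ
  choose σ hσ using fun T => hX.exists_segment p (c T)
  choose f hf using fun v => cauchySeq_tendsto_of_complete (hX.cauchySeq_segment hσ v)
  have hge : ∀ v : ℝ≥0, ∀ᶠ T in atTop, (v : ℝ) ≤ dist p (c T) := fun v =>
    (c.tendsto_dist_atTop p).eventually_ge_atTop v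
  refine ⟨⟨f, Isometry.of_dist_eq fun s t => ?_⟩, ?_, ?_⟩
  · refine tendsto_nhds_unique ((hf s).dist (hf t)) (tendsto_const_nhds.congr' ?_)
    filter_upwards [hge s, hge t] with T h₁ h₂
    rw [(hσ T).dist_eq _ ⟨s.coe_nonneg, h₁⟩ _ ⟨t.coe_nonneg, h₂⟩, NNReal.dist_eq]
  · refine tendsto_nhds_unique (hf 0) (tendsto_const_nhds.congr fun T => ?_)
    simp [(hσ T).source]
  · refine GeodesicRay.endpoint_eq_iff.2 ⟨3 * dist p (c 0), fun v => ?_⟩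
    refine le_of_tendsto ((hf v).dist tendsto_const_nhds) ?_
    filter_upwards [hge v, eventually_ge_atTop v] with T h₁ h₂
    exact hX.dist_segment_le (hσ T) h₁ h₂

end IsCAT0

/-! ### The cone topology -/

namespace VisualBordification

variable {X : Type*} [MetricSpace X]

theorem isOpen_coneNeighborhood (c : GeodesicRay X) {r : ℝ≥0} {ε : ℝ} (hr : 0 < r) (hε : 0 < ε) :
    IsOpen (coneNeighborhood c r ε) :=
  TopologicalSpace.isOpen_generateFrom_of_mem (.inr ⟨c, r, ε, hr, hε, rfl⟩)

theorem isOpen_image_point {U : Set X} (hU : IsOpen U) : IsOpen (point '' U) :=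
  TopologicalSpace.isOpen_generateFrom_of_mem (.inl ⟨U, hU, rfl⟩)

theorem ideal_endpoint_mem_coneNeighborhood (c : GeodesicRay X) (r : ℝ≥0) {ε : ℝ} (hε : 0 < ε) :
    ideal c.endpoint ∈ coneNeighborhood c r ε :=
  ⟨c, rfl, rfl, by simpa using hε⟩

theorem continuous_point (hX : IsCAT0 X) : Continuous (point : X → VisualBordification X) := by
  refine continuous_generateFrom_iff.2 ?_
  rintro _ (⟨U, hU, rfl⟩ | ⟨c, r, ε, -, hε, rfl⟩)
  · rwa [preimage_image_eq _ fun a b h => by injection h]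
  · rw [Metric.isOpen_iff]
    rintro x ⟨hx, γ, hγ, hγε⟩
    refine ⟨min (dist (c 0) x - r) (ε - dist (γ r) (c r)),
      lt_min (sub_pos.2 hx) (sub_pos.2 hγε), fun y hy => ?_⟩
    rw [Metric.mem_ball, lt_min_iff] at hy
    have hy' : (r : ℝ) < dist (c 0) y := by
      linarith [dist_triangle (c 0) y x, hy.1]
    obtain ⟨γ', hγ'⟩ := hX.exists_segment (c 0) y
    refine ⟨hy', γ', hγ', ?_⟩
    have := hX.dist_le_of_eq hγ' hγ ⟨r.coe_nonneg, hy'.le⟩ ⟨r.coe_nonneg, hx.le⟩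
    linarith [dist_triangle (γ' r) (γ r) (c r)]

theorem tendsto_point_ray (hX : IsCAT0 X) (c : GeodesicRay X) :
    Tendsto (fun T => point (c T)) atTop (𝓝 (ideal c.endpoint)) := by
  refine TopologicalSpace.tendsto_nhds_generateFrom_iff.2 ?_
  rintro _ (⟨U, -, rfl⟩ | ⟨a, r, ε, -, -, rfl⟩) h
  · simp at h
  · obtain ⟨c', h0, hc', hε⟩ := h
    choose σ hσ using fun T => hX.exists_segment (c' 0) (c T)
    have hlim := hX.tendsto_segment (GeodesicRay.endpoint_eq_iff.1 hc') hσ r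
    filter_upwards [(c.tendsto_dist_atTop (a 0)).eventually_gt_atTop r,
      (hlim.dist tendsto_const_nhds).eventually_lt_const hε] with T h₁ h₂
    exact ⟨h₁, σ T, h0 ▸ hσ T, h₂⟩

end VisualBordification

/-! ### Busemann functions -/

/-- The Busemann function of a ray, normalized to vanish at its origin. -/
noncomputable def GeodesicRay.busemann {X : Type*} [MetricSpace X] (c : GeodesicRay X) (x : X) :
    ℝ :=
  ⨅ T : ℝ≥0, (dist x (c T) - T)

namespace GeodesicRay

variable {X : Type*} [MetricSpace X] (c : GeodesicRay X)

theorem neg_dist_le_dist_sub (x : X) (T : ℝ≥0) : -dist x (c 0) ≤ dist x (c T) - T := by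
  have := dist_triangle_left (c 0) (c T) x
  rw [c.dist_zero_apply] at this
  linarith

theorem bddBelow_dist_sub (x : X) : BddBelow (range fun T : ℝ≥0 => dist x (c T) - T) :=
  ⟨-dist x (c 0), forall_mem_range.2 (c.neg_dist_le_dist_sub x)⟩

theorem busemann_le (x : X) (T : ℝ≥0) : c.busemann x ≤ dist x (c T) - T :=
  ciInf_le (c.bddBelow_dist_sub x) T

theorem busemann_le_dist_add (x y : X) : c.busemann x ≤ dist x y + c.busemann y := by
  rw [← sub_le_iff_le_add']
  refine le_ciInf fun T => ?_
  linarith [c.busemann_le x T, dist_triangle x y (c T)]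

theorem lipschitzWith_busemann : LipschitzWith 1 c.busemann :=
  LipschitzWith.of_le_add fun x y => by linarith [c.busemann_le_dist_add x y]

theorem busemann_origin : c.busemann (c 0) ≤ 0 := by
  simpa using c.busemann_le (c 0) 0

theorem tendsto_busemann (x : X) :
    Tendsto (fun T : ℝ≥0 => dist x (c T) - T) atTop (𝓝 (c.busemann x)) := by
  refine tendsto_atTop_ciInf (fun S T hST => ?_) (c.bddBelow_dist_sub x)
  have hST' : (S : ℝ) ≤ T := hST
  have h := c.dist_apply S T
  rw [abs_sub_comm, abs_of_nonneg (by linarith)] at h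
  have := dist_triangle x (c S) (c T)
  linarith

end GeodesicRay

namespace IsCAT0

variable {X : Type*} [MetricSpace X]

/-- Busemann functions decrease at unit speed along asymptotic rays. -/
theorem busemann_apply_le (hX : IsCAT0 X) {c c' : GeodesicRay X} (h : c.endpoint = c'.endpoint)
    (v : ℝ≥0) : c'.busemann (c v) ≤ c'.busemann (c 0) - v := by
  choose σ hσ using fun T => hX.exists_segment (c 0) (c' T)
  have hlim := hX.tendsto_segment (GeodesicRay.endpoint_eq_iff.1 h) hσ v
  refine le_of_tendsto_of_tendsto ((c'.lipschitzWith_busemann.continuous.tendsto _).comp hlim)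
    ((c'.tendsto_busemann (c 0)).sub_const v) ?_
  filter_upwards [(c'.tendsto_dist_atTop (c 0)).eventually_ge_atTop v] with T hT
  -- The point `σ T v` is closer to `c' T` than `c 0` is by exactly `v`.
  have h₁ := (hσ T).dist_target ⟨v.coe_nonneg, hT⟩
  have h₂ := c'.busemann_le (σ T v) T
  dsimp only [Function.comp]
  linarith

end IsCAT0

/-! ### Alexandrov angles -/

section Angles

variable {X : Type*} [MetricSpace X]

theorem comparisonAngle_nonneg (p x y : X) : 0 ≤ comparisonAngle p x y := Real.arccos_nonneg _

theorem comparisonAngle_le_pi (p x y : X) : comparisonAngle p x y ≤ Real.pi := Real.arccos_le_pi _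

theorem isBoundedUnder_le_comparisonAngle (c c' : GeodesicRay X) (l : Filter (ℝ≥0 × ℝ≥0)) :
    l.IsBoundedUnder (· ≤ ·) fun q => comparisonAngle (c 0) (c q.1) (c' q.2) :=
  isBoundedUnder_of ⟨Real.pi, fun _ => comparisonAngle_le_pi _ _ _⟩

theorem isCoboundedUnder_le_comparisonAngle (c c' : GeodesicRay X) (l : Filter (ℝ≥0 × ℝ≥0))
    [l.NeBot] : l.IsCoboundedUnder (· ≤ ·) fun q => comparisonAngle (c 0) (c q.1) (c' q.2) :=
  (isBoundedUnder_of ⟨0, fun _ => comparisonAngle_nonneg _ _ _⟩ :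
    l.IsBoundedUnder (· ≥ ·) _).isCoboundedUnder_le

theorem alexandrovAngle_le_pi (c c' : GeodesicRay X) : alexandrovAngle c c' ≤ Real.pi :=
  limsup_le_of_le (isCoboundedUnder_le_comparisonAngle c c' _)
    (.of_forall fun _ => comparisonAngle_le_pi _ _ _)

theorem alexandrovAngle_le_boundaryAngle {c c' : GeodesicRay X} (h : c 0 = c' 0) :
    alexandrovAngle c c' ≤ boundaryAngle c.endpoint c'.endpoint := by
  refine le_csSup ⟨Real.pi, ?_⟩ ⟨c 0, c, c', rfl, h.symm, rfl, rfl, rfl⟩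
  rintro _ ⟨_, c₁, c₂, -, -, -, -, rfl⟩
  exact alexandrovAngle_le_pi c₁ c₂

/-- If the Alexandrov angle of two rays is at most `π / 2`, then the law of cosines estimate for a
right angle holds at small scales up to an arbitrarily small relative error. -/
theorem eventually_sq_dist_le {c c' : GeodesicRay X} (h : c 0 = c' 0)
    (hangle : alexandrovAngle c c' ≤ Real.pi / 2) {ε : ℝ} (hε : 0 < ε) :
    ∀ᶠ q : ℝ≥0 × ℝ≥0 in 𝓝[>] (0 : ℝ≥0) ×ˢ 𝓝[>] (0 : ℝ≥0),
      dist (c q.1) (c' q.2) ^ 2 ≤ (q.1 : ℝ) ^ 2 + (q.2 : ℝ) ^ 2 + 2 * q.1 * q.2 * ε := by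
  -- This also holds for `ε > 1`, where `Real.arccos` is constantly `π`.
  have hlt : alexandrovAngle c c' < Real.arccos (-ε) :=
    hangle.trans_lt (not_le.1 fun h => by linarith [Real.arccos_le_pi_div_two.1 h])
  filter_upwards [eventually_lt_of_limsup_lt hlt (isBoundedUnder_le_comparisonAngle c c' _),
    prod_mem_prod self_mem_nhdsWithin self_mem_nhdsWithin] with q hq hpos
  have h₁ : (0 : ℝ) < q.1 := hpos.1
  have h₂ : (0 : ℝ) < q.2 := hpos.2
  have hq' : -ε < _ := not_le.1 fun hle => hq.not_ge (Real.antitone_arccos hle)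
  rw [lt_div_iff₀ (by rw [h, c'.dist_zero_apply, ← h, c.dist_zero_apply]; positivity),
    c.dist_zero_apply, h, c'.dist_zero_apply] at hq'
  linarith

/-- If the Alexandrov angle of two rays exceeds `π / 2`, then so does some comparison angle. -/
theorem exists_lt_sq_dist {c c' : GeodesicRay X} (h : c 0 = c' 0)
    (hangle : Real.pi / 2 < alexandrovAngle c c') :
    ∃ u v : ℝ≥0, 0 < u ∧ 0 < v ∧ (u : ℝ) ^ 2 + (v : ℝ) ^ 2 < dist (c u) (c' v) ^ 2 := by
  have hfr := frequently_lt_of_lt_limsup (isCoboundedUnder_le_comparisonAngle c c' _) hangle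
  obtain ⟨q, hq, hpos⟩ :=
    (hfr.and_eventually (prod_mem_prod self_mem_nhdsWithin self_mem_nhdsWithin)).exists
  have h₁ : (0 : ℝ) < q.1 := hpos.1
  have h₂ : (0 : ℝ) < q.2 := hpos.2
  refine ⟨q.1, q.2, hpos.1, hpos.2, ?_⟩
  rw [comparisonAngle, ← not_le, Real.arccos_le_pi_div_two, not_le, c.dist_zero_apply, h,
    c'.dist_zero_apply, div_lt_iff₀ (by positivity)] at hq
  linarith

theorem exists_alexandrovAngle_gt {ξ η : VisualBoundary X}
    (h : Real.pi / 2 < boundaryAngle η ξ) :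
    ∃ c c' : GeodesicRay X, c 0 = c' 0 ∧ c.endpoint = η ∧ c'.endpoint = ξ ∧
      Real.pi / 2 < alexandrovAngle c c' := by
  have hne : {θ : ℝ | ∃ (p : X) (c c' : GeodesicRay X), c 0 = p ∧ c' 0 = p ∧
      c.endpoint = η ∧ c'.endpoint = ξ ∧ θ = alexandrovAngle c c'}.Nonempty := by
    -- The default `sSup ∅ = 0` is below `π / 2`.
    by_contra hempty
    rw [not_nonempty_iff_eq_empty] at hempty
    rw [boundaryAngle, hempty, Real.sSup_empty] at h
    linarith [Real.pi_pos]
  obtain ⟨_, ⟨p, c, c', hc, hc', h₁, h₂, rfl⟩, hlt⟩ := exists_lt_of_lt_csSup hne h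
  exact ⟨c, c', hc.trans hc'.symm, h₁, h₂, hlt⟩

end Angles

/-! ### First variation of Busemann functions -/

namespace IsCAT0

variable {X : Type*} [MetricSpace X]

/-- If `η` and `ξ` are at angle at most `π / 2`, then the Busemann function of `η` does not increase
along rays that end at `ξ`. -/
theorem busemann_apply_nonpos (hX : IsCAT0 X) [CompleteSpace X] {c c' : GeodesicRay X}
    (hangle : boundaryAngle c'.endpoint c.endpoint ≤ Real.pi / 2) (h : c'.busemann (c 0) ≤ 0)
    (s : ℝ≥0) : c'.busemann (c s) ≤ 0 := by
  have hcont : Continuous fun x : ℝ => c'.busemann (c x.toNNReal) :=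
    c'.lipschitzWith_busemann.continuous.comp
      (c.isometry.continuous.comp continuous_real_toNNReal)
  -- It suffices that at each time the right slopes are frequently below every `r > 0`.
  have main := image_le_of_liminf_slope_right_le_deriv_boundary (a := (0 : ℝ)) (b := s)
    (f := fun x : ℝ => c'.busemann (c x.toNNReal)) (B := fun _ => 0) (B' := fun _ => 0)
    hcont.continuousOn (by simpa using h) continuousOn_const
    (fun x _ => hasDerivWithinAt_const _ _ _) ?_ (right_mem_Icc.2 s.coe_nonneg)
  · simpa using main
  intro x hx r hr
  obtain ⟨c₁, h₀, h₁⟩ := hX.exists_ray (c x.toNNReal) c'.endpoint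
  have h₀' : c₁ 0 = c.shift x.toNNReal 0 := by rw [h₀, GeodesicRay.shift_apply, add_zero]
  have hle := alexandrovAngle_le_boundaryAngle h₀'
  rw [h₁, c.endpoint_shift] at hle
  -- Currying fixes `v` on the ray to `η` first and then lets the step `u` along `c` tend to `0`.
  have hev := (eventually_sq_dist_le h₀' (hle.trans hangle) (half_pos hr)).curry
  obtain ⟨v, hv, hv0⟩ := (hev.and self_mem_nhdsWithin).exists
  have hv0' : (0 : ℝ) < v := hv0
  have hbus := hX.busemann_apply_le h₁ v
  have htend : Tendsto (fun z : ℝ => (z - x).toNNReal) (𝓝[>] x) (𝓝[>] 0) := by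
    refine tendsto_nhdsWithin_iff.2 ⟨?_, ?_⟩
    · refine Tendsto.mono_left ?_ nhdsWithin_le_nhds
      have : Continuous fun z : ℝ => (z - x).toNNReal := by fun_prop
      simpa using this.tendsto x
    · filter_upwards [self_mem_nhdsWithin] with z hz
      exact Real.toNNReal_pos.2 (sub_pos.2 hz)
  refine Eventually.frequently ?_
  -- The restriction `u < r * v` makes the second-order term `u² / (2 v)` smaller than `r u / 2`.
  filter_upwards [htend.eventually hv, self_mem_nhdsWithin,
    Ioo_mem_nhdsGT (show x < x + r * v by nlinarith)] with z hz hxz hzr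
  have hxz' : x < z := hxz
  set u := z - x with hu
  have hu0 : 0 < u := sub_pos.2 hxz'
  have hadd : x.toNNReal + u.toNNReal = z.toNNReal := by
    rw [← Real.toNNReal_add hx.1 hu0.le, hu, add_sub_cancel]
  rw [GeodesicRay.shift_apply, hadd, Real.coe_toNNReal _ hu0.le] at hz
  have hd : dist (c₁ v) (c z.toNNReal) ≤ v + r / 2 * u + u ^ 2 / (2 * v) := by
    refine (sq_le_sq₀ dist_nonneg (by positivity)).1 (hz.trans ?_)
    have e : ((v : ℝ) + r / 2 * u + u ^ 2 / (2 * v)) ^ 2 =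
        v ^ 2 + u ^ 2 + 2 * v * u * (r / 2) + (r / 2 * u + u ^ 2 / (2 * v)) ^ 2 := by
      field_simp
      ring
    rw [e]
    exact le_add_of_nonneg_right (sq_nonneg _)
  have hub : u ^ 2 / (2 * v) < r / 2 * u := by
    rw [div_lt_iff₀ (by positivity)]
    nlinarith [hzr.2, mul_pos hu0 (show 0 < r * v - u by linarith [hzr.2])]
  have hb := c'.busemann_le_dist_add (c z.toNNReal) (c₁ v)
  rw [dist_comm] at hb
  rw [h₀] at hbus
  rw [slope_def_field, div_lt_iff₀ hu0]
  linarith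

end IsCAT0

/-! ### Halfspaces and stars -/

section Star

variable {X : Type*} [MetricSpace X]

theorem mem_halfspaceCore_iff {Y : Type*} [TopologicalSpace Y] {ι : X → Y} {x₀ : X} {C : ℝ≥0}
    {ξ y : Y} :
    y ∈ halfspaceCore ι x₀ C ξ ↔
      ∀ V, IsOpen V → ξ ∈ V → ∀ U, IsOpen U → y ∈ U → ∃ z ∈ halfspace ι x₀ V C, ι z ∈ U := by
  simp only [halfspaceCore, mem_iInter, mem_ofPred_eq, and_imp, mem_closure_iff]
  refine forall₃_congr fun V _ _ => forall₃_congr fun U _ _ => ?_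
  constructor
  · rintro ⟨_, hU, z, hz, rfl⟩
    exact ⟨z, hz, hU⟩
  · rintro ⟨z, hz, hU⟩
    exact ⟨_, hU, z, hz, rfl⟩

theorem exists_dist_lt_of_mem_halfspace {Y : Type*} {ι : X → Y} {x₀ z : X} {C : ℝ≥0} {W : Set Y}
    (h : z ∈ halfspace ι x₀ W C) : ∃ w, ι w ∈ W ∧ dist z w < dist z x₀ + C + 1 := by
  have hlt : Metric.infEDist z (ι ⁻¹' W) < ENNReal.ofReal (dist z x₀ + C + 1) := by
    refine lt_of_le_of_lt h ?_
    rw [edist_dist, ← ENNReal.ofReal_coe_nnreal, ← ENNReal.ofReal_add dist_nonneg C.coe_nonneg]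
    exact (ENNReal.ofReal_lt_ofReal_iff (by positivity)).2 (lt_add_one _)
  obtain ⟨w, hw, hd⟩ := Metric.infEDist_lt_iff.1 hlt
  rw [edist_dist] at hd
  exact ⟨w, hw, (ENNReal.ofReal_lt_ofReal_iff (by positivity)).1 hd⟩

theorem basedStar_subset_starAtInfinity {Y : Type*} [TopologicalSpace Y] (ι : X → Y) (x₀ : X)
    (ξ : Y) : basedStar ι x₀ ξ ⊆ starAtInfinity ι x₀ ξ :=
  (subset_iUnion (fun C => halfspaceCore ι x₀ C ξ) 0).trans subset_closure

/-- Because of the outer closure, `U` must serve all `C` at once, while `V` may depend on `C`. The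
extra `1` is slack for the infimum not being attained. -/
theorem notMem_starAtInfinity {Y : Type*} [TopologicalSpace Y] {ι : X → Y} {x₀ : X} {ξ y : Y}
    {U : Set Y} (hU : IsOpen U) (hy : y ∈ U)
    (h : ∀ C : ℝ≥0, ∃ V, IsOpen V ∧ ξ ∈ V ∧
      ∀ z w, ι z ∈ U → ι w ∈ V → dist z x₀ + C + 1 ≤ dist z w) :
    y ∉ starAtInfinity ι x₀ ξ := by
  intro hmem
  obtain ⟨y', hy'U, hy'⟩ := mem_closure_iff.1 hmem U hU hy
  obtain ⟨C, hC⟩ := mem_iUnion.1 hy'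
  obtain ⟨V, hV, hξV, hsep⟩ := h C
  obtain ⟨z, hz, hzU⟩ := mem_halfspaceCore_iff.1 hC V hV hξV U hU hy'U
  obtain ⟨w, hw, hd⟩ := exists_dist_lt_of_mem_halfspace hz
  exact (hsep z w hzU hw).not_gt hd

open VisualBordification in
theorem point_notMem_starAtInfinity (x₀ : X) (ξ : VisualBoundary X) (x : X) :
    point x ∉ starAtInfinity point x₀ (ideal ξ) := by
  obtain ⟨c, rfl⟩ := GeodesicRay.exists_endpoint_eq ξ
  refine notMem_starAtInfinity (isOpen_image_point (Metric.isOpen_ball (x := x) (ε := 1)))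
    (mem_image_of_mem _ (Metric.mem_ball_self one_pos)) fun C => ?_
  -- Of the `3`, two units pay for replacing `z` by `x` in both distances, one for the slack.
  set R : ℝ≥0 := ⟨dist x x₀ + dist x (c 0) + C + 3, by positivity⟩ with hR
  have hR' : (R : ℝ) = dist x x₀ + dist x (c 0) + C + 3 := rfl
  have hR0 : 0 < R := by
    rw [← NNReal.coe_pos, hR']
    positivity
  refine ⟨_, isOpen_coneNeighborhood c hR0 one_pos,
    ideal_endpoint_mem_coneNeighborhood c R one_pos, ?_⟩
  rintro z w ⟨z', hz, hzz⟩ ⟨hw, -⟩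
  injection hzz with hzz
  subst hzz
  rw [Metric.mem_ball] at hz
  rw [hR'] at hw
  linarith [dist_triangle z' x x₀, dist_triangle4_left x (c 0) z' w, dist_triangle (c 0) x w,
    dist_triangle x z' w, dist_comm z' x, dist_comm x (c 0)]

open VisualBordification in
theorem IsCAT0.ideal_notMem_starAtInfinity (hX : IsCAT0 X) (x₀ : X) {ξ η : VisualBoundary X}
    (h : Real.pi / 2 < boundaryAngle η ξ) : ideal η ∉ starAtInfinity point x₀ (ideal ξ) := by
  obtain ⟨c, c', h₀, rfl, rfl, hangle⟩ := exists_alexandrovAngle_gt h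
  obtain ⟨u, v, hu, hv, huv⟩ := exists_lt_sq_dist h₀ hangle
  have hu' : (0 : ℝ) < u := hu
  have hv' : (0 : ℝ) < v := hv
  obtain ⟨m, hm₁, hm₂⟩ := exists_between (Real.sqrt_lt_sqrt (by positivity) huv)
  rw [Real.sqrt_sq dist_nonneg] at hm₂
  have hm0 : 0 ≤ m := (Real.sqrt_nonneg _).trans hm₁.le
  have hm : (u : ℝ) ^ 2 + (v : ℝ) ^ 2 < m ^ 2 := (Real.sqrt_lt' (hm0.lt_of_ne' ?_)).1 hm₁
  swap
  · rintro rfl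
    exact (Real.sqrt_nonneg _).not_gt hm₁
  -- Here `-κ` bounds the cosine of the comparison angle; `κ ≤ 1` is needed to complete the square
  -- below.
  set κ : ℝ := min 1 ((m ^ 2 - (u ^ 2 + v ^ 2)) / (2 * (u * v))) with hκ
  have hκ0 : 0 < κ := lt_min one_pos (div_pos (sub_pos.2 hm) (by positivity))
  have hκ1 : κ ≤ 1 := min_le_left _ _
  have hκm : (u : ℝ) ^ 2 + v ^ 2 + 2 * κ * (u * v) ≤ m ^ 2 := by
    have := min_le_right 1 (((m : ℝ) ^ 2 - (u ^ 2 + v ^ 2)) / (2 * (u * v)))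
    rw [← hκ, le_div_iff₀ (by positivity)] at this
    linarith
  -- Half the gap, since both endpoints move by less than `ε`.
  set ε : ℝ := (dist (c u) (c' v) - m) / 2 with hε
  have hε0 : 0 < ε := half_pos (sub_pos.2 hm₂)
  refine notMem_starAtInfinity (isOpen_coneNeighborhood c hu hε0)
    (ideal_endpoint_mem_coneNeighborhood c u hε0) fun C => ?_
  set R : ℝ≥0 := ⟨(dist (c 0) x₀ + C + 1) / κ, by positivity⟩ with hR
  have hRκ : κ * R = dist (c 0) x₀ + C + 1 := mul_div_cancel₀ _ hκ0.ne'
  have hR0 : 0 < R := by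
    rw [← NNReal.coe_pos]
    show (0 : ℝ) < (dist (c 0) x₀ + C + 1) / κ
    positivity
  refine ⟨_, (isOpen_coneNeighborhood c' hv hε0).inter (isOpen_coneNeighborhood c' hR0 one_pos),
    ⟨ideal_endpoint_mem_coneNeighborhood c' v hε0,
      ideal_endpoint_mem_coneNeighborhood c' R one_pos⟩, ?_⟩
  rintro z w ⟨hz, γ₁, hγ₁, hd₁⟩ ⟨⟨hw, γ₂, hγ₂, hd₂⟩, hwR, -⟩
  rw [← h₀] at hw hγ₂ hwR
  have hmd : m ≤ dist (γ₁ u) (γ₂ v) := by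
    have := dist_triangle4 (c u) (γ₁ u) (γ₂ v) (c' v)
    rw [dist_comm (c u) (γ₁ u)] at this
    linarith
  have hz0 := hu'.trans hz
  have hw0 := hv'.trans hw
  have key := hX.sq_dist_mul_le hγ₁ hγ₂ hz0 hw0 ⟨u.coe_nonneg, hz.le⟩ ⟨v.coe_nonneg, hw.le⟩
  have hsq := hκm.trans (pow_le_pow_left₀ hm0 hmd 2)
  have htri := dist_triangle z (c 0) x₀
  rw [dist_comm z (c 0)] at htri
  set a := dist (c 0) z
  set b := dist (c 0) w
  have hab : (u * v : ℝ) * (a ^ 2 + b ^ 2 + 2 * κ * (a * b)) ≤ u * v * dist z w ^ 2 := by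
    linarith [mul_le_mul_of_nonneg_right hsq (mul_pos hz0 hw0).le]
  -- As `κ ≤ 1`, `(a + κ b)² ≤ a² + b² + 2 κ a b`.
  have hzw : a + κ * b ≤ dist z w := by
    refine (sq_le_sq₀ (by positivity) dist_nonneg).1
      (le_trans ?_ (le_of_mul_le_mul_left hab (by positivity)))
    nlinarith [mul_nonneg (sq_nonneg b) (show 0 ≤ 1 - κ ^ 2 by nlinarith)]
  linarith [mul_le_mul_of_nonneg_left hwR.le hκ0.le]

open VisualBordification in
theorem IsCAT0.ideal_mem_basedStar (hX : IsCAT0 X) [CompleteSpace X] (x₀ : X)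
    {ξ η : VisualBoundary X} (h : boundaryAngle η ξ ≤ Real.pi / 2) :
    ideal η ∈ basedStar point x₀ (ideal ξ) := by
  obtain ⟨c, hc0, rfl⟩ := hX.exists_ray x₀ ξ
  obtain ⟨c', hc'0, rfl⟩ := hX.exists_ray x₀ η
  refine mem_halfspaceCore_iff.2 fun V hV hξ U hU hη => ?_
  obtain ⟨s, hs⟩ := ((tendsto_point_ray hX c).eventually (hV.mem_nhds hξ)).exists
  obtain ⟨ρ, hρ, hball⟩ := Metric.isOpen_iff.1 (hV.preimage (continuous_point hX)) (c s) hs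
  have hb := hX.busemann_apply_nonpos h (by rw [hc0, ← hc'0]; exact c'.busemann_origin) s
  obtain ⟨T, hT₁, hT₂, hT₃⟩ := (((tendsto_point_ray hX c').eventually (hU.mem_nhds hη)).and
    (((c'.tendsto_busemann (c s)).eventually_lt_const (hb.trans_lt (half_pos hρ))).and
      ((c'.tendsto_dist_atTop (c s)).eventually_ge_atTop (ρ / 2)))).exists
  obtain ⟨γ, hγ⟩ := hX.exists_segment (c s) (c' T)
  have hmem : ρ / 2 ∈ Icc 0 (dist (c s) (c' T)) := ⟨(half_pos hρ).le, hT₃⟩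
  -- Moving `ρ / 2` from `c s` towards `c' T` stays in `V` and leaves distance less than `T = dist
  -- x₀ (c' T)`.
  refine ⟨c' T, ?_, hT₁⟩
  have hγV : γ (ρ / 2) ∈ point ⁻¹' V := hball (by
    rw [Metric.mem_ball, dist_comm, hγ.dist_source hmem]
    exact half_lt_self hρ)
  refine (Metric.infEDist_le_edist_of_mem hγV).trans ?_
  rw [ENNReal.coe_zero, add_zero, edist_dist, edist_dist]
  refine ENNReal.ofReal_le_ofReal ?_
  rw [dist_comm, hγ.dist_target hmem, ← hc'0, dist_comm _ (c' 0), c'.dist_zero_apply]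
  linarith

end Star

theorem mainTheorem6 {X : Type*} [MetricSpace X] [CompleteSpace X] (hX : IsCAT0 X)
    (x₀ : X) (ξ : VisualBoundary X) :
    starAtInfinity VisualBordification.point x₀ (VisualBordification.ideal ξ) =
        basedStar VisualBordification.point x₀ (VisualBordification.ideal ξ) ∧
      basedStar VisualBordification.point x₀ (VisualBordification.ideal ξ) =
        VisualBordification.ideal '' {η : VisualBoundary X | boundaryAngle η ξ ≤ Real.pi / 2} := by
  have h₁ : VisualBordification.ideal '' {η : VisualBoundary X | boundaryAngle η ξ ≤ Real.pi / 2} ⊆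
      basedStar VisualBordification.point x₀ (VisualBordification.ideal ξ) :=
    image_subset_iff.2 fun η hη => hX.ideal_mem_basedStar x₀ hη
  have h₂ := basedStar_subset_starAtInfinity VisualBordification.point x₀
    (VisualBordification.ideal ξ)
  have h₃ : starAtInfinity VisualBordification.point x₀ (VisualBordification.ideal ξ) ⊆
      VisualBordification.ideal '' {η : VisualBoundary X | boundaryAngle η ξ ≤ Real.pi / 2} := by
    rintro (x | η) hy
    · exact absurd hy (point_notMem_starAtInfinity x₀ ξ x)
    · exact ⟨η, not_lt.1 fun hlt => hX.ideal_notMem_starAtInfinity x₀ hlt hy, rfl⟩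
  exact ⟨(h₃.trans h₁).antisymm h₂, (h₂.trans h₃).antisymm h₁⟩
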